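/- Let $X$ be a real Banach space and let $I=\psi+\Phi:X\to(-\infty,+\infty]$, where $\psi,\Phi:X\to(-\infty,+\infty]$ have effective domains $D_\psi=\{\psi<+\infty\}$, $D_\Phi=\{\Phi<+\infty\}$. Assume: (i) $D_\Phi$ is open and $D_I:=D_\Phi\cap D_\psi\neq\emptyset$; (ii) $\psi$ is convex and lower semicontinuous, and the restriction of $\psi$ to any nonempty compact set $K\subset X$ with $\sup_K\psi<+\infty$ is continuous; (iii) $\Phi$ is locally Lipschitz on $D_\Phi$, i.e. every $x\in D_\Phi$ has a neighbourhood $V\subset D_\Phi$ on which $\Phi$ is Lipschitz continuous; (iv) if $(u_n)$ is a sequence in $D_I$ with $\operatorname{dist}(u_n,\partial D_\Phi)\to0$, then $I(u_n)\to+\infty$ (with $\operatorname{dist}(\cdot,\emptyset)=+\infty$, so that this is void if $D_\Phi=X$). For $x\in D_\Phi$ and $u\in X$ let $\Phi^0(x;u)=\limsup_{w\to x,\;t\to0^+}\frac{\Phi(w+tu)-\Phi(w)}{t}$. A Palais–Smale sequence for $I$ at level $c\in\mathbb R$ is a sequence $(x_n)$ in $D_I$ such that $I(x_n)\to c$ and,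 for some sequence $\varepsilon_n>0$ with $\varepsilon_n\to0$, $$\Phi^0(x_n;z-x_n)+\psi(z)-\psi(x_n)\ge-\varepsilon_n\|z-x_n\|\qquad\text{for all }n\in\mathbb N,\ z\in X .$$ Let $B\subset X$ be closed and let $\mathcal F$ be a family of compact subsets of $X$ such that: 1. for every $A\in\mathcal F$ and every continuous $\eta:[0,1]\times X\to X$ with $\eta(t,x)=x$ for all $(t,x)\in(\{0\}\times X)\cup([0,1]\times B)$ and $\eta([0,1]\times A)\subset D_\Phi$, one has $\eta(\{1\}\times A)\in\mathcal F$; 2. $c:=\inf_{A\in\mathcal F}\sup_{x\in A}I(x)$ is a real number, i.e. $-\infty<c<+\infty$ (the lower bound is automatic if $B\ne\emptyset$); 3. $F\subset X$ is a closed set such that $(A\cap F)\setminus B\neq\emptyset$ for all $A\in\mathcal F$, and $\sup_BI\le\inf_FI$ (with $\sup_\emptyset I=-\infty$). Then for every sequence $(A_n)$ in $\mathcal F$ with $\lim_{n\to\infty}\sup_{A_n}I=c$ there exists a Palais–Smale sequence $(x_n)$ for $I$ at level $c$ such that $\operatorname{dist}(x_n,A_n)\to0$ and such that, if moreover $\inf_FI=c$,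 also $\operatorname{dist}(x_n,F)\to0$. -/

import Mathlib

open Set Filter Topology
open scoped NNReal ENNReal

namespace NonsmoothMinMax

noncomputable section

/-- The effective domain `{x | f x < +∞}` of an extended-real-valued function. -/
def effDomain {X : Type*} (f : X → EReal) : Set X := {x | f x < ⊤}

/-- `f` is locally Lipschitz continuous on its effective domain: every point of the domain has a
neighbourhood contained in the domain on which (the finite function) `f` is Lipschitz. -/
def LocallyLipschitzOnDomain {X : Type*} [NormedAddCommGroup X] (f : X → EReal) : Prop :=
  ∀ x ∈ effDomain f, ∃ V ∈ 𝓝 x, V ⊆ effDomain f ∧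
    ∃ C : ℝ≥0, LipschitzOnWith C (fun y => (f y).toReal) V

/-- The Clarke generalized directional derivative
`Φ⁰(x; u) = limsup_{w → x, t → 0⁺} (Φ(w + t u) - Φ(w)) / t`. It is used only at points `x` near
which `Φ` is finite and Lipschitz; there it is a finite number. -/
def clarkeDeriv {X : Type*} [NormedAddCommGroup X] [NormedSpace ℝ X]
    (Φ : X → EReal) (x u : X) : EReal :=
  limsup (fun p : X × ℝ => (Φ (p.1 + p.2 • u) - Φ p.1) / (p.2 : EReal)) (𝓝 x ×ˢ 𝓝[>] (0 : ℝ))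

/-- The standing assumptions on the functional `I = ψ + Φ : X → (-∞, +∞]`. The distance to the
boundary is the extended one, so that the distance to an empty boundary is `+∞` and
`tendsto_top_of_boundary` is void if `effDomain Φ` is the whole space. -/
structure IsAdmissible {X : Type*} [NormedAddCommGroup X] [NormedSpace ℝ X]
    (ψ Φ : X → EReal) : Prop where
  convex_ne_bot : ∀ x, ψ x ≠ ⊥
  lip_ne_bot : ∀ x, Φ x ≠ ⊥
  isOpen_domain : IsOpen (effDomain Φ)
  nonempty_domain : (effDomain Φ ∩ effDomain ψ).Nonempty
  convex : ∀ x y : X, ∀ a b : ℝ, 0 < a → 0 < b → a + b = 1 →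
    ψ (a • x + b • y) ≤ (a : EReal) * ψ x + (b : EReal) * ψ y
  lowerSemicontinuous : LowerSemicontinuous ψ
  continuousOn_compact : ∀ K : Set X, IsCompact K → K.Nonempty → (⨆ x ∈ K, ψ x) < ⊤ →
    ContinuousOn ψ K
  locallyLipschitz : LocallyLipschitzOnDomain Φ
  tendsto_top_of_boundary : ∀ u : ℕ → X, (∀ n, u n ∈ effDomain Φ ∩ effDomain ψ) →
    Tendsto (fun n => Metric.infEDist (u n) (frontier (effDomain Φ))) atTop (𝓝 0) →
    Tendsto (fun n => ψ (u n) + Φ (u n)) atTop (𝓝 ⊤)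

/-- `x` is a Palais–Smale sequence at level `c` for `I = ψ + Φ`. The terms lie in the domain of `I`,
which is what gives a meaning to `Φ⁰(xₙ; ·)` and to `- ψ(xₙ)`. -/
def IsPalaisSmaleSeq {X : Type*} [NormedAddCommGroup X] [NormedSpace ℝ X]
    (ψ Φ : X → EReal) (c : ℝ) (x : ℕ → X) : Prop :=
  (∀ n, x n ∈ effDomain Φ ∩ effDomain ψ) ∧
  Tendsto (fun n => ψ (x n) + Φ (x n)) atTop (𝓝 (c : EReal)) ∧
  ∃ ε : ℕ → ℝ, (∀ n, 0 < ε n) ∧ Tendsto ε atTop (𝓝 0) ∧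
    ∀ n, ∀ z : X,
      ((-(ε n * ‖z - x n‖) : ℝ) : EReal) ≤ clarkeDeriv Φ (x n) (z - x n) + ψ z - ψ (x n)

/-- The family `ℱ` is homotopy stable with extended boundary `B`, relative to the set `D`: only
deformations that keep the deformed member `A` of `ℱ` inside `D` are admitted. -/
def HomotopyStable {X : Type*} [TopologicalSpace X] (D B : Set X) (ℱ : Set (Set X)) : Prop :=
  ∀ A ∈ ℱ, ∀ η : C(unitInterval × X, X),
    (∀ x, η (0, x) = x) → (∀ t, ∀ x ∈ B, η (t, x) = x) → (∀ t, ∀ x ∈ A, η (t, x) ∈ D) →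
    (fun x => η (1, x)) '' A ∈ ℱ

end

end NonsmoothMinMax

/-!
The proof is a deformation argument by contradiction, carried out with Ekeland's principle.

If the Palais–Smale inequality with constant `ε` fails at `x` for a test point `z`, then moving
towards `z` decreases `I` at rate at least `ε` per unit length, and this holds for all starting
points near `x` although `ψ` is only lower semicontinuous (`IsAdmissible.descendsNear`). Hence it
suffices to find points without descent in the sense of `DescendsNear`. Descent at every point of a
compact set off `B` yields one deformation of the whole space which moves points by at most `s` in
time `s`, fixes `B`, never increases `I`, and decreases it at the full rate near the compact set
(`descendsUniformly_of_isCompact`).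

Blow-up at the boundary of the domain of `Φ` makes `I` lower semicontinuous on the whole space, so
that homotopies along which `I` stays below a fixed bound on `A` form a complete metric space,
without further reference to the domain. Ekeland's principle on that space gives a homotopy whose
final image `K` of `A` nearly minimizes the maximum of `I + g`, for a small penalty `g`; since `I`
is continuous on `K`, the maximum set is compact. If all its points admitted descent, the
deformation above would contradict the near minimality (`exists_not_descendsNear`).

The penalty serves two purposes when `inf_F I = c`: a cone over `F` locates the maximum points near
`F`, and a small multiple of the distance to `B` makes the maximum over any member of the family
strictly larger than the values on `B`, because every member meets `F` off `B`. Thus maximum points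
avoid `B` even though `B` and `F` may intersect. When `inf_F I < c`, the values on `B` are already
below `c` and no penalty is needed (`exists_almostCritical`). A diagonal choice of `ε` concludes.
-/

namespace NonsmoothMinMax

open scoped BoundedContinuousFunction

/-! ### Ekeland's variational principle -/

/-- Ekeland's variational principle, with the approximate minimizer located near a given point.
Along the sequence of nested closed sets `S (u n) = {y | f y + ε * dist (u n) y ≤ f (u n)}`, each
new point nearly minimizes `f` on the current set, which makes the diameters tend to `0`. -/
theorem exists_ekeland_point {Y : Type*} [MetricSpace Y] [CompleteSpace Y] {f : Y → ℝ}
    (hf : LowerSemicontinuous f) {m : ℝ} (hm : ∀ y, m ≤ f y) {ε : ℝ} (hε : 0 < ε) (x₀ : Y) :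
    ∃ x, f x + ε * dist x₀ x ≤ f x₀ ∧ ∀ y, f y + ε * dist x y ≤ f x → y = x := by
  set S : Y → Set Y := fun x => {y | f y + ε * dist x y ≤ f x} with hS
  have hself : ∀ x, x ∈ S x := fun x => by simp [hS]
  have hclosed : ∀ x, IsClosed (S x) := fun x =>
    (hf.add (by fun_prop : Continuous fun y => ε * dist x y).lowerSemicontinuous).isClosed_preimage
      (f x)
  have htrans : ∀ x y, y ∈ S x → S y ⊆ S x := by
    intro x y hy z hz
    simp only [hS, mem_ofPred_eq] at *
    nlinarith [dist_triangle x y z]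
  have hnext : ∀ (x : Y) (n : ℕ), ∃ y ∈ S x, ∀ z ∈ S x, f y ≤ f z + ε * (1 / 2) ^ n := by
    intro x n
    have hbdd : BddBelow (f '' S x) := ⟨m, by rintro _ ⟨y, -, rfl⟩; exact hm y⟩
    obtain ⟨_, ⟨y, hy, rfl⟩, hlt⟩ := exists_lt_of_csInf_lt (s := f '' S x) ⟨_, x, hself x, rfl⟩
      (lt_add_of_pos_right _ (by positivity : 0 < ε * (1 / 2 : ℝ) ^ n))
    refine ⟨y, hy, fun z hz => hlt.le.trans ?_⟩
    gcongr
    exact csInf_le hbdd ⟨z, hz, rfl⟩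
  choose next hmem hnext using hnext
  let u : ℕ → Y := fun n => Nat.rec x₀ (fun k x => next x k) n
  have hu : ∀ n, u (n + 1) = next (u n) n := fun n => rfl
  have hanti : Antitone fun n => S (u n) :=
    antitone_nat_of_succ_le fun n => htrans _ _ (hu n ▸ hmem _ _)
  have hsmall : ∀ n, ∀ z ∈ S (u (n + 1)), dist (u (n + 1)) z ≤ (1 / 2) ^ n := by
    intro n z hz
    have h1 := hnext (u n) n z (hanti n.le_succ hz)
    rw [← hu] at h1
    have h2 : f z + ε * dist (u (n + 1)) z ≤ f (u (n + 1)) := hz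
    exact le_of_mul_le_mul_left (by linarith) hε
  have hcauchy : CauchySeq fun n => u (n + 1) := by
    refine cauchySeq_of_le_geometric (1 / 2) 1 (by norm_num) fun n => ?_
    rw [one_mul]
    exact hsmall n _ (hanti (n + 1).le_succ (hself _))
  obtain ⟨x, hx⟩ := cauchySeq_tendsto_of_complete hcauchy
  have hxS : ∀ n, x ∈ S (u n) := fun n => (hclosed _).mem_of_tendsto hx <| by
    filter_upwards [eventually_ge_atTop n] with k hk
    exact hanti (hk.trans k.le_succ) (hself _)
  refine ⟨x, hxS 0, fun y hy => ?_⟩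
  have hy' : Tendsto (fun n => u (n + 1)) atTop (𝓝 y) := by
    rw [tendsto_iff_dist_tendsto_zero]
    exact squeeze_zero (fun _ => dist_nonneg) (fun n => hsmall n y (htrans _ _ (hxS (n + 1)) hy))
      (tendsto_pow_atTop_nhds_zero_of_lt_one (by norm_num) (by norm_num))
  exact tendsto_nhds_unique hy' hx

/-! ### Deformations built from local descent -/

/-- Near `x`, the functional `I` can be decreased at rate `ε`: some continuous motion `P`, moving
points by at most `s` in time `s`, decreases `I` by at least `ε * s`, for all starting points close
to `x` and all small times `s`. A decrease by `d` from `w` to `y` is written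
`∀ q : ℝ, I w ≤ q → I y ≤ q - d`, which is void if `I w = ⊤` and avoids subtraction in `EReal`. -/
def DescendsNear {X : Type*} [PseudoMetricSpace X] (I : X → EReal) (ε : ℝ) (x : X) : Prop :=
  ∃ r > 0, ∃ τ > 0, ∃ P : ℝ → X → X, Continuous (fun p : ℝ × X => P p.1 p.2) ∧
    (∀ w, P 0 w = w) ∧ (∀ s, 0 ≤ s → ∀ w, dist (P s w) w ≤ s) ∧
    ∀ w ∈ Metric.ball x r, ∀ s ∈ Icc 0 τ, ∀ q : ℝ, I w ≤ q → I (P s w) ≤ (q - ε * s : ℝ)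

/-- There is a continuous deformation `T` of the space, fixing `B` and moving points by at most `s`
in time `s`, along which, for small `s`, `I` decreases everywhere by at least `ε` times the
displacement, and by the full amount `ε * s` at all points of a uniform neighbourhood of `S`. -/
def DescendsUniformly {X : Type*} [PseudoMetricSpace X] (I : X → EReal) (ε : ℝ) (B S : Set X) :
    Prop :=
  ∃ ρ > 0, ∃ τ > 0, ∃ T : ℝ → X → X, Continuous (fun p : ℝ × X => T p.1 p.2) ∧
    (∀ w, T 0 w = w) ∧ (∀ s, ∀ w ∈ B, T s w = w) ∧
    (∀ s ∈ Icc 0 τ, ∀ w, dist (T s w) w ≤ s) ∧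
    (∀ s ∈ Icc 0 τ, ∀ w, ∀ q : ℝ, I w ≤ q → I (T s w) ≤ (q - ε * dist (T s w) w : ℝ)) ∧
    ∀ w ∈ Metric.thickening ρ S, ∀ s ∈ Icc 0 τ, ∀ q : ℝ, I w ≤ q → I (T s w) ≤ (q - ε * s : ℝ)

section Deformation

variable {X : Type*} [PseudoMetricSpace X] {I : X → EReal} {ε : ℝ} {B : Set X}

theorem exists_cutoff {ρ : ℝ} (hρ : 0 < ρ) (S : Set X) :
    ∃ α : X → ℝ, Continuous α ∧ (∀ x, 0 ≤ α x) ∧ (∀ x, α x ≤ 1) ∧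
      (∀ x ∈ Metric.thickening (ρ / 2) S, α x = 1) ∧ ∀ x, x ∉ Metric.thickening ρ S → α x = 0 := by
  have h2 : 0 < ρ / 2 := by positivity
  refine ⟨fun x => thickenedIndicator h2 (Metric.thickening (ρ / 2) S) x, ?_, fun x => ?_,
    fun x => ?_, fun x hx => ?_, fun x hx => ?_⟩
  · exact NNReal.continuous_coe.comp (thickenedIndicator h2 _).continuous
  · positivity
  · exact_mod_cast thickenedIndicator_le_one h2 _ x
  · simp [thickenedIndicator_one h2 _ hx]
  · have : x ∉ Metric.thickening (ρ / 2) (Metric.thickening (ρ / 2) S) := fun h => hx <| by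
      simpa using Metric.thickening_thickening_subset _ _ _ h
    simp [thickenedIndicator_zero h2 _ this]

theorem DescendsNear.exists_descendsUniformly (hε : 0 ≤ ε) (hB : IsClosed B) {x : X}
    (hx : DescendsNear I ε x) (hxB : x ∉ B) : ∃ V ∈ 𝓝 x, DescendsUniformly I ε B V := by
  obtain ⟨r, hr, τ, hτ, P, hPc, hP0, hPd, hP⟩ := hx
  obtain ⟨r', hr', hball⟩ := Metric.isOpen_iff.1 hB.isOpen_compl x hxB
  set d := min r r' with hd
  have hd0 : 0 < d := lt_min hr hr'
  obtain ⟨β, hβc, hβ0, hβ1, hβone, hβzero⟩ := exists_cutoff hd0 ({x} : Set X)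
  have hzero : ∀ w, w ∉ Metric.ball x d → β w = 0 := fun w hw => hβzero w (by simpa using hw)
  have hdrop : ∀ s ∈ Icc 0 τ, ∀ w, ∀ q : ℝ, I w ≤ q →
      I (P (s * β w) w) ≤ (q - ε * (s * β w) : ℝ) := by
    intro s hs w q hq
    by_cases hw : w ∈ Metric.ball x d
    · refine hP w (Metric.ball_subset_ball (min_le_left _ _) hw) _ ⟨?_, ?_⟩ q hq
      · exact mul_nonneg hs.1 (hβ0 w)
      · exact (mul_le_of_le_one_right hs.1 (hβ1 w)).trans hs.2
    · simpa [hzero w hw, hP0] using hq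
  have hdist : ∀ s ∈ Icc 0 τ, ∀ w, dist (P (s * β w) w) w ≤ s * β w := fun s hs w =>
    hPd _ (mul_nonneg hs.1 (hβ0 w)) w
  refine ⟨Metric.ball x (d / 4), Metric.ball_mem_nhds _ (by positivity), d / 4, by positivity,
    τ, hτ, fun s w => P (s * β w) w, ?_, ?_, ?_, ?_, ?_, ?_⟩
  · exact hPc.comp (by fun_prop : Continuous fun p : ℝ × X => (p.1 * β p.2, p.2))
  · intro w
    simp [hP0]
  · intro s w hw
    have : w ∉ Metric.ball x d := fun h => hball (Metric.ball_subset_ball (min_le_right _ _) h) hw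
    simp [hzero w this, hP0]
  · intro s hs w
    exact (hdist s hs w).trans (mul_le_of_le_one_right hs.1 (hβ1 w))
  · intro s hs w q hq
    refine (hdrop s hs w q hq).trans (EReal.coe_le_coe_iff.2 ?_)
    have := hdist s hs w
    gcongr
  · intro w hw s hs q hq
    have hw1 : β w = 1 := by
      refine hβone w ?_
      rw [Metric.thickening_singleton, Metric.mem_ball]
      obtain ⟨y, hy, hwy⟩ := Metric.mem_thickening_iff.1 hw
      rw [Metric.mem_ball] at hy
      linarith [dist_triangle w y x]
    simpa [hw1] using hdrop s hs w q hq

/-- Follow the first deformation for the part `α w * s` of the time, where `α` is a cut-off function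
living on the region of full descent of the first one, and the second deformation for the rest of
the time. Sharing the time, rather than composing at full speed, keeps the displacement
at most `s`. -/
theorem DescendsUniformly.union (hε : 0 ≤ ε) {S₁ S₂ : Set X} (h₁ : DescendsUniformly I ε B S₁)
    (h₂ : DescendsUniformly I ε B S₂) : DescendsUniformly I ε B (S₁ ∪ S₂) := by
  obtain ⟨ρ₁, hρ₁, τ₁, hτ₁, T₁, hc₁, h0₁, hB₁, hd₁, hw₁, hs₁⟩ := h₁
  obtain ⟨ρ₂, hρ₂, τ₂, hτ₂, T₂, hc₂, h0₂, hB₂, hd₂, hw₂, hs₂⟩ := h₂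
  obtain ⟨α, hαc, hα0, hα1, hαone, hαzero⟩ := exists_cutoff hρ₁ S₁
  set τ := min (min τ₁ τ₂) (ρ₂ / 2) with hτ
  have hmem₁ : ∀ s ∈ Icc 0 τ, ∀ w, α w * s ∈ Icc 0 τ₁ := fun s hs w =>
    ⟨mul_nonneg (hα0 w) hs.1, (mul_le_of_le_one_left hs.1 (hα1 w)).trans
      (hs.2.trans ((min_le_left _ _).trans (min_le_left _ _)))⟩
  have hmem₂ : ∀ s ∈ Icc 0 τ, ∀ w, (1 - α w) * s ∈ Icc 0 τ₂ := fun s hs w =>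
    ⟨mul_nonneg (sub_nonneg.2 (hα1 w)) hs.1,
      (mul_le_of_le_one_left hs.1 (by linarith [hα0 w])).trans
      (hs.2.trans ((min_le_left _ _).trans (min_le_right _ _)))⟩
  have hfirst : ∀ s ∈ Icc 0 τ, ∀ w, ∀ q : ℝ, I w ≤ q →
      I (T₁ (α w * s) w) ≤ (q - ε * (α w * s) : ℝ) := by
    intro s hs w q hq
    by_cases hw : w ∈ Metric.thickening ρ₁ S₁
    · exact hs₁ w hw _ (hmem₁ s hs w) q hq
    · simpa [hαzero w hw, h0₁] using hq
  refine ⟨min (ρ₁ / 2) (ρ₂ / 2), by positivity, τ, by positivity,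
    fun s w => T₂ ((1 - α w) * s) (T₁ (α w * s) w), ?_, ?_, ?_, ?_, ?_, ?_⟩
  · have h : Continuous fun p : ℝ × X => T₁ (α p.2 * p.1) p.2 :=
      hc₁.comp (by fun_prop : Continuous fun p : ℝ × X => (α p.2 * p.1, p.2))
    exact hc₂.comp (by fun_prop :
      Continuous fun p : ℝ × X => ((1 - α p.2) * p.1, T₁ (α p.2 * p.1) p.2))
  · intro w
    simp [h0₁, h0₂]
  · intro s w hw
    simp only [hB₁ _ w hw, hB₂ _ w hw]
  · intro s hs w
    have h1 := hd₁ _ (hmem₁ s hs w) w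
    have h2 := hd₂ _ (hmem₂ s hs w) (T₁ (α w * s) w)
    have := dist_triangle (T₂ ((1 - α w) * s) (T₁ (α w * s) w)) (T₁ (α w * s) w) w
    linarith
  · intro s hs w q hq
    have h1 := hw₁ _ (hmem₁ s hs w) w q hq
    have h2 := hw₂ _ (hmem₂ s hs w) _ _ h1
    refine h2.trans (EReal.coe_le_coe_iff.2 ?_)
    have := dist_triangle (T₂ ((1 - α w) * s) (T₁ (α w * s) w)) (T₁ (α w * s) w) w
    nlinarith
  · intro w hw s hs q hq
    rw [Metric.thickening_union] at hw
    have h1 := hfirst s hs w q hq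
    rcases hw with hw | hw
    · have hα : α w = 1 := hαone w (Metric.thickening_mono (min_le_left _ _) _ hw)
      simpa [hα, h0₂] using h1
    · have hy : T₁ (α w * s) w ∈ Metric.thickening ρ₂ S₂ := by
        obtain ⟨y, hy, hwy⟩ := Metric.mem_thickening_iff.1 hw
        refine Metric.mem_thickening_iff.2 ⟨y, hy, ?_⟩
        have h3 := hd₁ _ (hmem₁ s hs w) w
        have h4 : α w * s ≤ ρ₂ / 2 :=
          (mul_le_of_le_one_left hs.1 (hα1 w)).trans (hs.2.trans (min_le_right _ _))
        have h5 := hwy.trans_le (min_le_right _ _)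
        linarith [dist_triangle (T₁ (α w * s) w) w y]
      have h2 := hs₂ _ hy _ (hmem₂ s hs w) _ h1
      refine h2.trans_eq ?_
      congr 1
      ring

theorem descendsUniformly_of_isCompact (hε : 0 ≤ ε) (hB : IsClosed B) {M : Set X} (hM : IsCompact M)
    (hMB : ∀ x ∈ M, x ∉ B) (hdesc : ∀ x ∈ M, DescendsNear I ε x) :
    DescendsUniformly I ε B M := by
  refine hM.induction_on (p := DescendsUniformly I ε B) ?_ ?_ ?_ ?_
  · refine ⟨1, one_pos, 1, one_pos, fun _ w => w, continuous_snd, fun _ => rfl, fun _ _ _ => rfl,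
      fun s hs w => by simpa using hs.1, fun s _ w q hq => by simpa using hq, ?_⟩
    simp
  · rintro S S' hSS' ⟨ρ, hρ, τ, hτ, T, hc, h0, hB, hd, hw, hs⟩
    exact ⟨ρ, hρ, τ, hτ, T, hc, h0, hB, hd, hw, fun w hwS =>
      hs w (Metric.thickening_subset_of_subset ρ hSS' hwS)⟩
  · exact fun S S' h h' => h.union hε h'
  · intro x hx
    obtain ⟨V, hV, h⟩ := (hdesc x hx).exists_descendsUniformly hε hB (hMB x hx)
    exact ⟨V, mem_nhdsWithin_of_mem_nhds hV, h⟩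

end Deformation

theorem lowerSemicontinuous_toReal {Y : Type*} [TopologicalSpace Y] {h : Y → EReal}
    (hh : LowerSemicontinuous h) (hbot : ∀ y, h y ≠ ⊥) (htop : ∀ y, h y ≠ ⊤) :
    LowerSemicontinuous fun y => (h y).toReal := by
  intro y s hs
  replace hs : (s : EReal) < h y := by
    rwa [← EReal.coe_toReal (htop y) (hbot y), EReal.coe_lt_coe_iff]
  filter_upwards [hh y s hs] with z hz
  exact EReal.coe_lt_coe_iff.1 (by rwa [EReal.coe_toReal (htop z) (hbot z)])

/-! ### The min-max argument -/

/-- For a homotopy stable family and a penalty `g` such that `I + g` is at most `l` on `B`, while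
its supremum over every member of the family exceeds `l`, there is, near each member `A`, a point
of value above `l` at which `I` does not descend.

Ekeland's principle, applied to `v ↦ sup_A (I + g) ∘ (id + v (1, ·))` on the complete space of the
displacement fields `v` of the admitted homotopies, yields a homotopy that nearly minimizes. The
maximum set of `I + g` over the final image of `A` is compact and misses `B`. Were descent possible
at all its points, a uniform deformation following that homotopy would lower the supremum too much
for its size. -/
theorem exists_not_descendsNear {X : Type*} [NormedAddCommGroup X] [CompleteSpace X]
    {I : X → EReal} (hbot : ∀ x, I x ≠ ⊥) (hlsc : LowerSemicontinuous I) {b : ℝ}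
    (hcont : ∀ K : Set X, IsCompact K → (∀ x ∈ K, I x ≤ b) →
      ContinuousOn (fun x => (I x).toReal) K)
    {D B A : Set X} (hD : ∀ x, I x ≤ b → x ∈ D) (hB : IsClosed B) {ℱ : Set (Set X)}
    (hstable : HomotopyStable D B ℱ) (hA : A ∈ ℱ) (hAc : IsCompact A) (hAb : ∀ a ∈ A, I a ≤ b)
    {g : X → ℝ} {κ : ℝ≥0} (hg : LipschitzWith κ g) {G : ℝ} (hgG : ∀ x, g x ≤ G) {l : ℝ}
    (hlB : ∀ y ∈ B, I y + (g y : EReal) ≤ l)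
    (hl : ∀ K ∈ ℱ, ∃ k ∈ K, (l : EReal) < I k + (g k : EReal))
    {ε ε' : ℝ} (hε' : 0 < ε') (hε : κ + ε' < ε) :
    ∃ x, I x ≤ b ∧ (l : EReal) < I x + (g x : EReal) ∧ (∃ a ∈ A, ε' * dist x a ≤ b + G - l) ∧
      ¬ DescendsNear I ε x := by
  have hκ : (0 : ℝ) ≤ κ := κ.2
  have hε0 : 0 < ε := by linarith
  set f : X → ℝ := fun x => (I x).toReal + g x with hf
  have hcoe : ∀ x, I x ≤ b → ((I x).toReal : EReal) = I x := fun x hx =>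
    EReal.coe_toReal (ne_top_of_le_ne_top (EReal.coe_ne_top b) hx) (hbot x)
  have hfcoe : ∀ x, I x ≤ b → (f x : EReal) = I x + g x := fun x hx => by
    rw [hf, EReal.coe_add, hcoe x hx]
  have hfle : ∀ x, I x ≤ b → f x ≤ b + G := fun x hx => by
    have : (I x).toReal ≤ b := EReal.coe_le_coe_iff.1 ((hcoe x hx).trans_le hx)
    exact add_le_add this (hgG x)
  -- Displacement fields of homotopies. The bound `I ≤ b` along the whole homotopy is a closed
  -- condition, by lower semicontinuity, and it keeps the images of `A` inside `D`.
  let L : Set (unitInterval × X →ᵇ X) := {v | (∀ x, v (0, x) = 0) ∧ (∀ t, ∀ x ∈ B, v (t, x) = 0) ∧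
    ∀ t, ∀ a ∈ A, I (a + v (t, a)) ≤ b}
  have hLclosed : IsClosed L := by
    have h1 : ∀ p : unitInterval × X, Continuous fun v : unitInterval × X →ᵇ X => v p :=
      fun p => continuous_eval_const p
    have h3 : ∀ t a, IsClosed {v : unitInterval × X →ᵇ X | I (a + v (t, a)) ≤ b} := fun t a =>
      (hlsc.isClosed_preimage (b : EReal)).preimage (continuous_const.add (h1 (t, a)))
    simp only [L, ofPred_and, ofPred_forall]
    refine IsClosed.inter ?_ (IsClosed.inter ?_ ?_)
    · exact isClosed_iInter fun x => isClosed_eq (h1 _) continuous_const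
    · exact isClosed_iInter fun t => isClosed_iInter fun x => isClosed_iInter fun _ =>
        isClosed_eq (h1 _) continuous_const
    · exact isClosed_iInter fun t => isClosed_iInter fun a => isClosed_iInter fun _ => h3 t a
  have hLcomplete : CompleteSpace L := hLclosed.completeSpace_coe
  have hLimage : ∀ v ∈ L, (fun x => x + v (1, x)) '' A ∈ ℱ := fun v hv =>
    hstable A hA ⟨fun p => p.2 + v p, by fun_prop⟩ (fun x => by simp [hv.1])
      (fun t x hx => by simp [hv.2.1 t x hx]) (fun t x hx => hD _ (hv.2.2 t x hx))
  obtain ⟨a₀, ha₀, -⟩ := hl A hA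
  have : Nonempty A := ⟨⟨a₀, ha₀⟩⟩
  let J : L → ℝ := fun v => ⨆ a : A, f (a + v.1 (1, (a : X)))
  have hJbdd : ∀ v : L, BddAbove (range fun a : A => f (a + v.1 (1, (a : X)))) := fun v =>
    ⟨b + G, by rintro _ ⟨a, rfl⟩; exact hfle _ (v.2.2.2 1 a a.2)⟩
  have hJle : ∀ v : L, ∀ a ∈ A, f (a + v.1 (1, a)) ≤ J v := fun v a ha =>
    le_ciSup (hJbdd v) ⟨a, ha⟩
  have hJl : ∀ v : L, l < J v := by
    intro v
    obtain ⟨_, ⟨a, ha, rfl⟩, hk⟩ := hl _ (hLimage v.1 v.2)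
    rw [← hfcoe _ (v.2.2.2 1 a ha), EReal.coe_lt_coe_iff] at hk
    exact hk.trans_le (hJle v a ha)
  have hJlsc : LowerSemicontinuous J := by
    refine lowerSemicontinuous_ciSup hJbdd fun a => ?_
    have h1 : Continuous fun v : L => (a : X) + v.1 (1, (a : X)) :=
      continuous_const.add
        ((continuous_eval_const ((1 : unitInterval), (a : X))).comp continuous_subtype_val)
    refine LowerSemicontinuous.add (lowerSemicontinuous_toReal (hlsc.comp h1)
      (fun v => hbot _) fun v => ?_) (hg.continuous.comp h1).lowerSemicontinuous
    exact ne_top_of_le_ne_top (EReal.coe_ne_top b) (v.2.2.2 1 a a.2)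
  have h0 : (0 : unitInterval × X →ᵇ X) ∈ L :=
    ⟨fun _ => rfl, fun _ _ _ => rfl, fun t a ha => by simpa using hAb a ha⟩
  obtain ⟨v, hv0, hvmin⟩ := exists_ekeland_point hJlsc (fun v => (hJl v).le) hε' ⟨0, h0⟩
  have hJ0 : J ⟨0, h0⟩ ≤ b + G := ciSup_le fun a => hfle _ (h0.2.2 1 a a.2)
  set K : Set X := (fun x => x + v.1 (1, x)) '' A with hK
  have hKc : IsCompact K := hAc.image (by fun_prop)
  have hKb : ∀ x ∈ K, I x ≤ b := by
    rintro _ ⟨a, ha, rfl⟩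
    exact v.2.2.2 1 a ha
  have hfK : ContinuousOn f K := (hcont K hKc hKb).add hg.continuous.continuousOn
  have hKJ : ∀ x ∈ K, f x ≤ J v := by
    rintro _ ⟨a, ha, rfl⟩
    exact hJle v a ha
  -- the maximum points of `f` on `K`; the superlevel set form makes closedness immediate
  set M : Set X := K ∩ f ⁻¹' Ici (J v) with hM
  have hMc : IsCompact M :=
    hKc.of_isClosed_subset (hfK.preimage_isClosed_of_isClosed hKc.isClosed isClosed_Ici)
      inter_subset_left
  have hMB : ∀ x ∈ M, x ∉ B := by
    intro x hx hxB
    have h1 := hlB x hxB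
    rw [← hfcoe x (hKb x hx.1), EReal.coe_le_coe_iff] at h1
    exact absurd (hx.2.trans h1) (hJl v).not_ge
  by_contra hcon
  push Not at hcon
  have hdesc : ∀ x ∈ M, DescendsNear I ε x := by
    intro x hx
    obtain ⟨a, ha, hax⟩ := hx.1
    refine hcon x (hKb x hx.1) ?_ ⟨a, ha, ?_⟩
    · rw [← hfcoe x (hKb x hx.1), EReal.coe_lt_coe_iff]
      exact (hJl v).trans_le hx.2
    · have h1 : dist x a ≤ dist (⟨0, h0⟩ : L) v := by
        rw [Subtype.dist_eq, dist_comm (0 : unitInterval × X →ᵇ X)]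
        refine le_trans ?_ (BoundedContinuousFunction.dist_coe_le_dist (1, a))
        rw [← hax, dist_eq_norm, dist_eq_norm]
        simp
      have := hJl v
      have := mul_le_mul_of_nonneg_left h1 hε'.le
      linarith
  obtain ⟨ρ, hρ, τ, hτ, T, hTc, hT0, hTB, hTd, hTw, hTs⟩ :=
    descendsUniformly_of_isCompact hε0.le hB hMc hMB hdesc
  -- away from the maximum points, the functional has a gap below its maximum
  obtain ⟨θ, hθ, hgap⟩ : ∃ θ > 0, ∀ x ∈ K, x ∉ Metric.thickening ρ M → f x ≤ J v - θ := by
    have hNc : IsCompact (K \ Metric.thickening ρ M) := hKc.diff Metric.isOpen_thickening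
    rcases (K \ Metric.thickening ρ M).eq_empty_or_nonempty with hN | hN
    · refine ⟨1, one_pos, fun x hx hxM => ?_⟩
      exact absurd (hN ▸ ⟨hx, hxM⟩ : x ∈ (∅ : Set X)) (notMem_empty x)
    · obtain ⟨y, hy, hymax⟩ := hNc.exists_isMaxOn hN (hfK.mono sdiff_subset)
      refine ⟨J v - f y, sub_pos.2 (not_le.1 fun h => hy.2 ?_), fun x hx hxM => ?_⟩
      · exact Metric.self_subset_thickening hρ M ⟨hy.1, h⟩
      · rw [sub_sub_cancel]
        exact hymax ⟨hx, hxM⟩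
  -- small enough for the gap `θ` to absorb the decrease required of the maximum
  set s : ℝ := min τ (θ / (ε - κ)) with hs
  have hs0 : 0 < s := lt_min hτ (div_pos hθ (by linarith))
  have hsθ : (ε - κ) * s ≤ θ := by
    rw [mul_comm, ← le_div_iff₀ (by linarith)]
    exact min_le_right _ _
  have hsmem : ∀ t : unitInterval, (t : ℝ) * s ∈ Icc 0 τ := fun t =>
    ⟨mul_nonneg t.2.1 hs0.le, (mul_le_of_le_one_left hs0.le t.2.2).trans (min_le_left _ _)⟩
  have hsIcc : s ∈ Icc 0 τ := ⟨hs0.le, min_le_left _ _⟩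
  -- let the deformation act after the nearly optimal one
  let w : unitInterval × X →ᵇ X := v.1 + BoundedContinuousFunction.ofNormedAddCommGroup
    (fun p : unitInterval × X => T (p.1 * s) (p.2 + v.1 p) - (p.2 + v.1 p))
    ((hTc.comp (by fun_prop :
      Continuous fun p : unitInterval × X => ((p.1 : ℝ) * s, p.2 + v.1 p))).sub (by fun_prop)) s
    fun p => by
      rw [← dist_eq_norm]
      exact (hTd _ (hsmem p.1) _).trans (mul_le_of_le_one_left hs0.le p.1.2.2)
  have hw : ∀ t x, x + w (t, x) = T (t * s) (x + v.1 (t, x)) := fun t x => by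
    simp only [w, BoundedContinuousFunction.coe_add, Pi.add_apply,
      BoundedContinuousFunction.coe_ofNormedAddCommGroup]
    abel
  have hwL : w ∈ L := by
    refine ⟨fun x => ?_, fun t x hx => ?_, fun t a ha => ?_⟩
    · have := hw 0 x
      rw [v.2.1 x] at this
      simpa [hT0] using this
    · have := hw t x
      rw [v.2.2.1 t x hx, add_zero, hTB _ x hx] at this
      simpa using this
    · rw [hw]
      refine (hTw _ (hsmem t) _ b (v.2.2.2 t a ha)).trans (EReal.coe_le_coe_iff.2 ?_)
      have : 0 ≤ ε * dist (T (t * s) (a + v.1 (t, a))) (a + v.1 (t, a)) := by positivity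
      linarith
  have hreal : ∀ x y : X, ∀ d : ℝ, I x ≤ b →
      (∀ q : ℝ, I x ≤ q → I y ≤ (q - d : ℝ)) → (I y).toReal ≤ (I x).toReal - d := by
    intro x y d hx h
    have h1 := h _ (hcoe x hx).ge
    rwa [← EReal.coe_toReal (ne_top_of_le_ne_top (EReal.coe_ne_top _) h1) (hbot y),
      EReal.coe_le_coe_iff] at h1
  have hgT : ∀ x, g (T s x) ≤ g x + κ * dist (T s x) x := fun x => hg.le_add_mul _ _
  have hJw : J ⟨w, hwL⟩ ≤ J v - (ε - κ) * s := by
    refine ciSup_le fun a => ?_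
    have h1 : ((a : X) + w (1, (a : X))) = T s (a + v.1 (1, (a : X))) := by simp [hw]
    rw [h1]
    set x : X := a + v.1 (1, (a : X)) with hx
    have hxK : x ∈ K := ⟨a, a.2, rfl⟩
    have h2 := hgT x
    by_cases hxM : x ∈ Metric.thickening ρ M
    · have h3 := hreal x (T s x) _ (hKb x hxK) (hTs x hxM s hsIcc)
      have h4 := mul_le_mul_of_nonneg_left (hTd s hsIcc x) hκ
      have h5 := hKJ x hxK
      simp only [hf] at h5 ⊢
      linarith
    · have h3 := hreal x (T s x) _ (hKb x hxK) (hTw s hsIcc x)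
      have h4 := hgap x hxK hxM
      have h5 : κ * dist (T s x) x ≤ ε * dist (T s x) x := by gcongr; linarith
      simp only [hf] at h4 ⊢
      linarith
  have hdist : dist v ⟨w, hwL⟩ ≤ s := by
    rw [Subtype.dist_eq, dist_comm, BoundedContinuousFunction.dist_le hs0.le]
    rintro ⟨t, x⟩
    have h1 : dist (w (t, x)) (v.1 (t, x)) = dist (x + w (t, x)) (x + v.1 (t, x)) := by simp
    rw [h1, hw]
    exact (hTd _ (hsmem t) _).trans (mul_le_of_le_one_left hs0.le t.2.2)
  have hpos : 0 < (ε - κ) * s := mul_pos (by linarith) hs0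
  have heq := hvmin ⟨w, hwL⟩ (by nlinarith [mul_le_mul_of_nonneg_left hdist hε'.le])
  rw [heq] at hJw
  linarith

/-- The truncated distance to `B`, or the constant `1` if `B` is empty, in which case `infDist`
would vanish identically. -/
theorem exists_lipschitz_pos_off {X : Type*} [PseudoMetricSpace X] {B : Set X} (hB : IsClosed B) :
    ∃ h : X → ℝ, LipschitzWith 1 h ∧ (∀ x, h x ≤ 1) ∧ (∀ x ∈ B, h x = 0) ∧ ∀ x ∉ B, 0 < h x := by
  rcases B.eq_empty_or_nonempty with rfl | hne
  · exact ⟨fun _ => 1, LipschitzWith.const' 1, by simp, by simp, by simp⟩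
  · refine ⟨fun x => min (Metric.infDist x B) 1, (Metric.lipschitz_infDist_pt B).min_const 1,
      fun x => min_le_right _ _, fun x hx => by simp [Metric.infDist_zero_of_mem hx],
      fun x hx => ?_⟩
    exact lt_min ((hB.notMem_iff_infDist_pos hne).1 hx) one_pos

/-- The quantitative form of the min-max theorem, for a lower semicontinuous functional and with
criticality expressed through descent. -/
theorem exists_almostCritical {X : Type*} [NormedAddCommGroup X] [CompleteSpace X]
    {I : X → EReal} (hbot : ∀ x, I x ≠ ⊥) (hlsc : LowerSemicontinuous I)
    (hcont : ∀ b : ℝ, ∀ K : Set X, IsCompact K → (∀ x ∈ K, I x ≤ b) →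
      ContinuousOn (fun x => (I x).toReal) K)
    {D B F : Set X} (hD : ∀ x, I x < ⊤ → x ∈ D) (hB : IsClosed B) {ℱ : Set (Set X)}
    (hcompact : ∀ A ∈ ℱ, IsCompact A) (hstable : HomotopyStable D B ℱ) {c : ℝ}
    (hc : (⨅ A ∈ ℱ, ⨆ x ∈ A, I x) = (c : EReal))
    (hmeet : ∀ A ∈ ℱ, ((A ∩ F) \ B).Nonempty)
    (hsep : (⨆ x ∈ B, I x) ≤ ⨅ x ∈ F, I x) {ε : ℝ} (hε : 0 < ε) :
    ∃ δ > 0, ∀ A ∈ ℱ, (∀ a ∈ A, I a ≤ (c + δ : ℝ)) →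
      ∃ x, I x ≤ (c + ε : ℝ) ∧ ((c - ε : ℝ) : EReal) ≤ I x ∧ Metric.infDist x A ≤ ε ∧
        ((⨅ y ∈ F, I y) = (c : EReal) → Metric.infDist x F ≤ ε) ∧ ¬ DescendsNear I ε x := by
  have hD' : ∀ b : ℝ, ∀ x, I x ≤ b → x ∈ D := fun b x hx => hD x (hx.trans_lt (EReal.coe_lt_top b))
  have hsup : ∀ K ∈ ℱ, (c : EReal) ≤ ⨆ x ∈ K, I x := fun K hK => hc ▸ iInf₂_le K hK
  have hFc : (⨅ y ∈ F, I y) ≤ (c : EReal) := by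
    rw [← hc]
    refine le_iInf₂ fun K hK => ?_
    obtain ⟨k, ⟨hkK, hkF⟩, -⟩ := hmeet K hK
    exact (iInf₂_le k hkF).trans (le_iSup₂ (f := fun x (_ : x ∈ K) => I x) k hkK)
  have hreal : ∀ {x : X} {u v : ℝ}, (u : EReal) < I x + (v : EReal) → I x ≠ ⊤ →
      ((u - v : ℝ) : EReal) ≤ I x := by
    intro x u v h htop
    rw [← EReal.coe_toReal htop (hbot x), ← EReal.coe_add, EReal.coe_lt_coe_iff] at h
    rw [← EReal.coe_toReal htop (hbot x), EReal.coe_le_coe_iff]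
    linarith
  rcases hFc.lt_or_eq with hlt | heq
  · -- the boundary lies strictly below the level `c`, so that no penalty is needed
    obtain ⟨q, hq1, hq2⟩ := EReal.lt_iff_exists_real_btwn.1 hlt
    rw [EReal.coe_lt_coe_iff] at hq2
    set δ := min (min ε (ε ^ 2 / 4)) (c - q) with hδ
    have hδ0 : 0 < δ := lt_min (by positivity) (sub_pos.2 hq2)
    have hδ1 : δ ≤ ε := (min_le_left _ _).trans (min_le_left _ _)
    have hδ2 : δ ≤ ε ^ 2 / 4 := (min_le_left _ _).trans (min_le_right _ _)
    have hδ3 : δ ≤ c - q := min_le_right _ _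
    refine ⟨δ, hδ0, fun A hA hAb => ?_⟩
    obtain ⟨x, hxb, hxl, ⟨a, ha, hxa⟩, hx⟩ := exists_not_descendsNear hbot hlsc (hcont (c + δ))
      (hD' _) hB hstable hA (hcompact A hA) hAb (g := fun _ => 0) (LipschitzWith.const 0)
      (G := 0) (fun _ => le_rfl) (l := c - δ)
      (fun y hy => by
        simp only [EReal.coe_zero, add_zero]
        refine (le_iSup₂ (f := fun x (_ : x ∈ B) => I x) y hy).trans (hsep.trans (hq1.le.trans ?_))
        exact EReal.coe_le_coe_iff.2 (by linarith))
      (fun K hK => by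
        simp only [EReal.coe_zero, add_zero]
        have h : ((c - δ : ℝ) : EReal) < ⨆ x ∈ K, I x :=
          (EReal.coe_lt_coe_iff.2 (by linarith)).trans_le (hsup K hK)
        obtain ⟨k, hk⟩ := lt_iSup_iff.1 h
        obtain ⟨hkK, hk⟩ := lt_iSup_iff.1 hk
        exact ⟨k, hkK, hk⟩)
      (ε := ε) (ε' := ε / 2) (by positivity) (by simpa using hε)
    refine ⟨x, hxb.trans (EReal.coe_le_coe_iff.2 (by linarith)), ?_, ?_,
      fun h => absurd h hlt.ne, hx⟩
    · have := hreal hxl (ne_top_of_le_ne_top (EReal.coe_ne_top _) hxb)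
      exact (EReal.coe_le_coe_iff.2 (by linarith)).trans this
    · refine (Metric.infDist_le_dist_of_mem ha).trans ?_
      nlinarith
  · -- The penalty is a cone over `F` of height `ε ^ 2 / 4`, vanishing at distance `ε`, plus a
    -- small multiple of the truncated distance to `B`. Where the cone vanishes and `I ≤ c + δ`,
    -- the penalized value is at most `c + 2 * δ ≤ c + ε ^ 2 / 4`; so higher points lie within `ε`
    -- of `F`. The second term makes the value at points of `F` off `B` exceed strictly the values
    -- on `B`.
    obtain ⟨h, hhL, hh1, hhB, hhpos⟩ := exists_lipschitz_pos_off hB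
    set δ := min (ε / 4) (ε ^ 2 / 8) with hδ
    have hδ0 : 0 < δ := by positivity
    have hδ1 : δ ≤ ε / 4 := min_le_left _ _
    have hδ2 : δ ≤ ε ^ 2 / 8 := min_le_right _ _
    let g : X → ℝ := fun x => max (ε / 4 * (ε - Metric.infDist x F)) 0 + δ * h x
    have hcone : ∀ x, max (ε / 4 * (ε - Metric.infDist x F)) 0 ≤ ε ^ 2 / 4 := fun x => by
      refine max_le ?_ (by positivity)
      nlinarith [Metric.infDist_nonneg (x := x) (s := F)]
    have hgG : ∀ x, g x ≤ ε ^ 2 / 4 + δ := fun x =>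
      add_le_add (hcone x) (mul_le_of_le_one_right hδ0.le (hh1 x))
    have hgL : LipschitzWith (ε / 2).toNNReal g := by
      refine LipschitzWith.of_le_add_mul _ fun x y => ?_
      rw [Real.coe_toNNReal _ (by positivity)]
      have h1 : Metric.infDist y F ≤ Metric.infDist x F + dist x y := by
        rw [dist_comm]
        exact Metric.infDist_le_infDist_add_dist
      have h2 : h x ≤ h y + dist x y := by simpa using hhL.le_add_mul x y
      have h3 : max (ε / 4 * (ε - Metric.infDist x F)) 0 ≤
          max (ε / 4 * (ε - Metric.infDist y F)) 0 + ε / 4 * dist x y := by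
        refine max_le ?_ (by positivity)
        nlinarith [le_max_left (ε / 4 * (ε - Metric.infDist y F)) 0]
      have h4 : δ * dist x y ≤ ε / 4 * dist x y := by gcongr
      simp only [g]
      nlinarith
    refine ⟨δ, hδ0, fun A hA hAb => ?_⟩
    obtain ⟨x, hxb, hxl, ⟨a, ha, hxa⟩, hx⟩ := exists_not_descendsNear hbot hlsc (hcont (c + δ))
      (hD' _) hB hstable hA (hcompact A hA) hAb hgL hgG (l := c + ε ^ 2 / 4)
      (fun y hy => by
        rw [EReal.coe_add c]
        refine add_le_add ?_ (EReal.coe_le_coe_iff.2 ?_)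
        · rw [← heq]
          exact (le_iSup₂ (f := fun x (_ : x ∈ B) => I x) y hy).trans hsep
        · simpa [g, hhB y hy] using hcone y)
      (fun K hK => by
        obtain ⟨k, ⟨hkK, hkF⟩, hkB⟩ := hmeet K hK
        refine ⟨k, hkK, ?_⟩
        have h1 : (c : EReal) ≤ I k := heq ▸ iInf₂_le k hkF
        have h2 : ε ^ 2 / 4 < g k := by
          simp only [g, Metric.infDist_zero_of_mem hkF]
          have := mul_pos hδ0 (hhpos k hkB)
          have := le_max_left (ε / 4 * (ε - 0)) 0
          nlinarith
        calc ((c + ε ^ 2 / 4 : ℝ) : EReal) < ((c + g k : ℝ) : EReal) :=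
              EReal.coe_lt_coe_iff.2 (by linarith)
          _ = c + (g k : EReal) := EReal.coe_add _ _
          _ ≤ I k + g k := by gcongr)
      (ε := ε) (ε' := ε / 4) (by positivity)
      (by rw [Real.coe_toNNReal _ (by positivity)]; linarith)
    have hxlow := hreal hxl (ne_top_of_le_ne_top (EReal.coe_ne_top _) hxb)
    refine ⟨x, hxb.trans (EReal.coe_le_coe_iff.2 (by linarith)), ?_, ?_, fun _ => ?_, hx⟩
    · exact (EReal.coe_le_coe_iff.2 (by linarith [hgG x])).trans hxlow
    · refine (Metric.infDist_le_dist_of_mem ha).trans ?_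
      nlinarith
    · have h1 : c + ε ^ 2 / 4 < c + δ + g x := by
        have := hxl.trans_le (add_le_add hxb le_rfl)
        rwa [← EReal.coe_add, EReal.coe_lt_coe_iff] at this
      have h2 : 0 < max (ε / 4 * (ε - Metric.infDist x F)) 0 := by
        have : δ * h x ≤ δ := mul_le_of_le_one_right hδ0.le (hh1 x)
        simp only [g] at h1
        linarith
      rw [lt_max_iff, or_iff_left (lt_irrefl _)] at h2
      have := pos_of_mul_pos_right h2 (by positivity)
      linarith

/-! ### The nonsmooth functional -/

theorem coe_toReal_of_mem {X : Type*} {f : X → EReal} (hf : ∀ x, f x ≠ ⊥) {x : X}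
    (hx : x ∈ effDomain f) :
    ((f x).toReal : EReal) = f x :=
  EReal.coe_toReal (ne_of_lt hx) (hf x)

theorem LocallyLipschitzOnDomain.continuousOn_toReal {X : Type*} [NormedAddCommGroup X]
    {Φ : X → EReal} (h : LocallyLipschitzOnDomain Φ) :
    ContinuousOn (fun x => (Φ x).toReal) (effDomain Φ) := by
  intro x hx
  obtain ⟨V, hV, -, C, hC⟩ := h x hx
  exact (hC.continuousOn.continuousAt hV).continuousWithinAt

section Admissible

variable {X : Type*} [NormedAddCommGroup X] [NormedSpace ℝ X] {ψ Φ : X → EReal}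

theorem IsAdmissible.add_ne_bot (h : IsAdmissible ψ Φ) (x : X) : ψ x + Φ x ≠ ⊥ := by
  simp [EReal.add_eq_bot_iff, h.convex_ne_bot x, h.lip_ne_bot x]

theorem IsAdmissible.mem_domain (h : IsAdmissible ψ Φ) {x : X} (hx : ψ x + Φ x < ⊤) :
    x ∈ effDomain Φ ∩ effDomain ψ := by
  constructor
  · refine (lt_top_iff_ne_top (a := Φ x)).2 fun hΦ => ?_
    rw [hΦ, EReal.add_top_of_ne_bot (h.convex_ne_bot x)] at hx
    exact lt_irrefl _ hx
  · refine (lt_top_iff_ne_top (a := ψ x)).2 fun hψ => ?_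
    rw [hψ, EReal.top_add_of_ne_bot (h.lip_ne_bot x)] at hx
    exact lt_irrefl _ hx

/-- The sum is lower semicontinuous on the whole space: a limit of points of a sublevel set cannot
lie on the boundary of the domain of `Φ`, because the functional blows up there. -/
theorem IsAdmissible.lowerSemicontinuous_add (h : IsAdmissible ψ Φ) :
    LowerSemicontinuous fun x => ψ x + Φ x := by
  rw [lowerSemicontinuous_iff_isClosed_preimage]
  intro y
  induction y using EReal.rec with
  | bot =>
    convert isClosed_empty (X := X)
    ext x
    simpa using h.add_ne_bot x
  | top => simp
  | coe s =>
    refine isClosed_of_closure_subset fun x hx => ?_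
    obtain ⟨u, hu, hux⟩ := mem_closure_iff_seq_limit.1 hx
    have hdom : ∀ n, u n ∈ effDomain Φ ∩ effDomain ψ := fun n =>
      h.mem_domain (lt_of_le_of_lt (hu n) (EReal.coe_lt_top s))
    have hxΦ : x ∈ effDomain Φ := by
      by_contra hxΦ
      have hfr : x ∈ frontier (effDomain Φ) := by
        rw [h.isOpen_domain.frontier_eq]
        exact ⟨mem_closure_of_tendsto hux (.of_forall fun n => (hdom n).1), hxΦ⟩
      have hdist : Tendsto (fun n => Metric.infEDist (u n) (frontier (effDomain Φ))) atTop (𝓝 0) :=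
        tendsto_of_tendsto_of_tendsto_of_le_of_le tendsto_const_nhds
          (tendsto_iff_edist_tendsto_0.1 hux) (fun _ => bot_le)
          fun n => Metric.infEDist_le_edist_of_mem hfr
      obtain ⟨n, hn⟩ := ((h.tendsto_top_of_boundary u hdom hdist).eventually
        (lt_mem_nhds (EReal.coe_lt_top s))).exists
      exact absurd (hu n) (not_le.2 hn)
    have hΦx := coe_toReal_of_mem h.lip_ne_bot hxΦ
    have hΦlim : Tendsto (fun n => (Φ (u n)).toReal) atTop (𝓝 (Φ x).toReal) :=
      ((h.locallyLipschitz.continuousOn_toReal).continuousAt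
        (h.isOpen_domain.mem_nhds hxΦ)).tendsto.comp hux
    by_contra hlt
    have hlt' : (s : EReal) < ψ x + Φ x := not_le.1 hlt
    have hψ : ((s - (Φ x).toReal : ℝ) : EReal) < ψ x := by
      refine lt_of_not_ge fun hle => hlt'.not_ge ?_
      rw [← hΦx]
      refine (add_le_add hle le_rfl).trans_eq ?_
      rw [← EReal.coe_add, sub_add_cancel]
    obtain ⟨q, hq1, hq2⟩ := EReal.lt_iff_exists_real_btwn.1 hψ
    rw [EReal.coe_lt_coe_iff] at hq1
    obtain ⟨n, hn1, hn2⟩ := ((hux.eventually (h.lowerSemicontinuous x q hq2)).and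
      (hΦlim.eventually (lt_mem_nhds (show s - q < (Φ x).toReal by linarith)))).exists
    have hsum : ((q + (s - q) : ℝ) : EReal) < ψ (u n) + Φ (u n) := by
      rw [EReal.coe_add, ← coe_toReal_of_mem h.lip_ne_bot (hdom n).1]
      exact EReal.add_lt_add hn1 (EReal.coe_lt_coe_iff.2 hn2)
    rw [add_sub_cancel] at hsum
    exact absurd (hu n) (not_le.2 hsum)

theorem IsAdmissible.continuousOn_toReal_add (h : IsAdmissible ψ Φ) {b : ℝ} {K : Set X}
    (hK : IsCompact K) (hKb : ∀ x ∈ K, ψ x + Φ x ≤ b) :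
    ContinuousOn (fun x => (ψ x + Φ x).toReal) K := by
  rcases K.eq_empty_or_nonempty with rfl | hne
  · exact continuousOn_empty _
  have hdom : ∀ x ∈ K, x ∈ effDomain Φ ∩ effDomain ψ := fun x hx =>
    h.mem_domain ((hKb x hx).trans_lt (EReal.coe_lt_top b))
  have hΦ : ContinuousOn (fun x => (Φ x).toReal) K :=
    h.locallyLipschitz.continuousOn_toReal.mono fun x hx => (hdom x hx).1
  obtain ⟨m, hm⟩ := hK.bddBelow_image hΦ
  have hψ : ContinuousOn ψ K := by
    refine h.continuousOn_compact K hK hne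
      (lt_of_le_of_lt (iSup₂_le fun x hx => ?_) (EReal.coe_lt_top (b - m)))
    have h1 := hKb x hx
    have h2 : m ≤ (Φ x).toReal := hm ⟨x, hx, rfl⟩
    rw [← coe_toReal_of_mem h.lip_ne_bot (hdom x hx).1,
      ← coe_toReal_of_mem h.convex_ne_bot (hdom x hx).2, ← EReal.coe_add,
      EReal.coe_le_coe_iff] at h1
    rw [← coe_toReal_of_mem h.convex_ne_bot (hdom x hx).2, EReal.coe_le_coe_iff]
    linarith
  have hψ' : ContinuousOn (fun x => (ψ x).toReal) K := fun x hx =>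
    (EReal.tendsto_toReal (ne_of_lt (hdom x hx).2) (h.convex_ne_bot x)).comp (hψ x hx)
  refine (hψ'.add hΦ).congr fun x hx => ?_
  exact EReal.toReal_add (ne_of_lt (hdom x hx).2) (h.convex_ne_bot x)
    (ne_of_lt (hdom x hx).1) (h.lip_ne_bot x)

theorem tendsto_add_smul_nhds (x u : X) :
    Tendsto (fun p : X × ℝ => p.1 + p.2 • u) (𝓝 x ×ˢ 𝓝[>] (0 : ℝ)) (𝓝 x) := by
  have h : Tendsto (fun p : X × ℝ => p.1 + p.2 • u) (𝓝 (x, 0)) (𝓝 (x + (0 : ℝ) • u)) :=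
    Continuous.tendsto (by fun_prop) (x, 0)
  rw [zero_smul, add_zero, nhds_prod_eq] at h
  exact h.mono_left (prod_mono le_rfl nhdsWithin_le_nhds)

/-- The generalized derivative is bounded below by the local Lipschitz constant; in particular it is
never `⊥`, so that sums with `ψ z = ⊤` are not spoiled by the convention `⊥ + ⊤ = ⊥`. -/
theorem LocallyLipschitzOnDomain.le_clarkeDeriv (h : LocallyLipschitzOnDomain Φ)
    (hbot : ∀ x, Φ x ≠ ⊥) {x : X} (hx : x ∈ effDomain Φ) :
    ∃ C : ℝ, ∀ u, ((-(C * ‖u‖) : ℝ) : EReal) ≤ clarkeDeriv Φ x u := by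
  obtain ⟨V, hV, hVdom, C, hC⟩ := h x hx
  refine ⟨C, fun u => le_limsup_of_frequently_le (Eventually.frequently ?_)⟩
  filter_upwards [tendsto_fst.eventually hV, (tendsto_add_smul_nhds x u).eventually hV,
    tendsto_snd.eventually self_mem_nhdsWithin] with p h1 h2 ht
  replace ht : 0 < p.2 := ht
  rw [← coe_toReal_of_mem hbot (hVdom h1), ← coe_toReal_of_mem hbot (hVdom h2), ← EReal.coe_sub,
    ← EReal.coe_div, EReal.coe_le_coe_iff, le_div_iff₀ ht]
  have h3 := hC.dist_le_mul _ h2 _ h1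
  rw [Real.dist_eq, dist_eq_norm, add_sub_cancel_left, norm_smul, Real.norm_of_nonneg ht.le] at h3
  linarith [(abs_le.1 h3).1]

/-- If the Palais–Smale inequality fails at `x` for the test point `z`, then the functional
decreases along the segments from points near `x` towards `z`. Lower semicontinuity of `ψ` is what
lets the strict inequality persist near `x`: convexity bounds the increment of `ψ` along the
segment from `w` by a multiple of `ψ z - ψ w`, and `ψ w` is at least almost `ψ x`. -/
theorem IsAdmissible.eventually_descent (h : IsAdmissible ψ Φ) {x z : X}
    (hx : x ∈ effDomain Φ ∩ effDomain ψ) {ε : ℝ}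
    (hz : clarkeDeriv Φ x (z - x) + ψ z - ψ x < ((-(ε * ‖z - x‖) : ℝ) : EReal)) :
    ∀ᶠ p : X × ℝ in 𝓝 x ×ˢ 𝓝[>] (0 : ℝ), ∀ q : ℝ, ψ p.1 + Φ p.1 ≤ q →
      ψ (p.1 + p.2 • (z - p.1)) + Φ (p.1 + p.2 • (z - p.1)) ≤
        (q - ε * (p.2 * ‖z - p.1‖) : ℝ) := by
  obtain ⟨V, hV, hVdom, C, hC⟩ := h.locallyLipschitz x hx.1
  obtain ⟨C', hC'⟩ := h.locallyLipschitz.le_clarkeDeriv h.lip_ne_bot hx.1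
  have hψx := coe_toReal_of_mem h.convex_ne_bot hx.2
  have hk_bot : clarkeDeriv Φ x (z - x) ≠ ⊥ := fun hk =>
    absurd (hC' (z - x)) (by rw [hk]; exact not_le.2 (EReal.bot_lt_coe _))
  have hz_top : ψ z ≠ ⊤ := fun hψz => by
    rw [hψz, EReal.add_top_of_ne_bot hk_bot, ← hψx, EReal.top_sub_coe] at hz
    exact absurd hz not_top_lt
  have hk_top : clarkeDeriv Φ x (z - x) ≠ ⊤ := fun hk => by
    rw [hk, EReal.top_add_of_ne_bot (h.convex_ne_bot z), ← hψx, EReal.top_sub_coe] at hz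
    exact absurd hz not_top_lt
  have hψz := EReal.coe_toReal hz_top (h.convex_ne_bot z)
  have hk := EReal.coe_toReal hk_top hk_bot
  set k := (clarkeDeriv Φ x (z - x)).toReal
  set pz := (ψ z).toReal
  set px := (ψ x).toReal
  rw [← hk, ← hψz, ← hψx, ← EReal.coe_add, ← EReal.coe_sub, EReal.coe_lt_coe_iff] at hz
  -- one fourth of the available room for each of the four approximations below
  set θ := (-(ε * ‖z - x‖) - (k + pz - px)) / 4 with hθ
  have hθ0 : 0 < θ := by linarith
  have hquot : ∀ᶠ p : X × ℝ in 𝓝 x ×ˢ 𝓝[>] (0 : ℝ),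
      (Φ (p.1 + p.2 • (z - x)) - Φ p.1) / (p.2 : EReal) < ((k + θ : ℝ) : EReal) := by
    refine eventually_lt_of_limsup_lt (lt_of_eq_of_lt hk.symm ?_)
    exact EReal.coe_lt_coe_iff.2 (by linarith)
  have hnew : Tendsto (fun p : X × ℝ => p.1 + p.2 • (z - p.1)) (𝓝 x ×ˢ 𝓝[>] (0 : ℝ)) (𝓝 x) := by
    have h1 : Tendsto (fun p : X × ℝ => p.1 + p.2 • (z - p.1)) (𝓝 (x, 0))
        (𝓝 (x + (0 : ℝ) • (z - x))) := Continuous.tendsto (by fun_prop) (x, 0)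
    rw [zero_smul, add_zero, nhds_prod_eq] at h1
    exact h1.mono_left (prod_mono le_rfl nhdsWithin_le_nhds)
  have hψlow : ∀ᶠ w in 𝓝 x, ((px - θ : ℝ) : EReal) < ψ w :=
    h.lowerSemicontinuous x _ (lt_of_lt_of_eq (EReal.coe_lt_coe_iff.2 (by linarith)) hψx)
  have hCsmall : ∀ᶠ w in 𝓝 x, C * ‖w - x‖ < θ := by
    have : Tendsto (fun w => (C : ℝ) * ‖w - x‖) (𝓝 x) (𝓝 (C * ‖x - x‖)) :=
      Continuous.tendsto (by fun_prop) x
    exact this.eventually (gt_mem_nhds (by simpa using hθ0))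
  have hnorm : ∀ᶠ w in 𝓝 x, ε * ‖z - w‖ < ε * ‖z - x‖ + θ := by
    have : Tendsto (fun w => ε * ‖z - w‖) (𝓝 x) (𝓝 (ε * ‖z - x‖)) :=
      Continuous.tendsto (by fun_prop) x
    exact this.eventually (gt_mem_nhds (by linarith))
  have hlt1 : ∀ᶠ t in 𝓝[>] (0 : ℝ), t < 1 := nhdsWithin_le_nhds (gt_mem_nhds one_pos)
  filter_upwards [hquot, tendsto_fst.eventually hV, (tendsto_add_smul_nhds x (z - x)).eventually hV,
    hnew.eventually hV, tendsto_fst.eventually hψlow, tendsto_fst.eventually hCsmall,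
    tendsto_fst.eventually hnorm, tendsto_snd.eventually hlt1,
    tendsto_snd.eventually self_mem_nhdsWithin]
  rintro ⟨w, t⟩ hq1 hw hwu hwn hψw hCw hnw ht1 ht0 q hq
  simp only at hq1 hw hwu hwn hψw hCw hnw ht1 hq ⊢
  replace ht0 : 0 < t := ht0
  have hwψ := coe_toReal_of_mem h.convex_ne_bot
    (h.mem_domain (hq.trans_lt (EReal.coe_lt_top q))).2
  have hΦw := coe_toReal_of_mem h.lip_ne_bot (hVdom hw)
  have hΦwu := coe_toReal_of_mem h.lip_ne_bot (hVdom hwu)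
  have hΦwn := coe_toReal_of_mem h.lip_ne_bot (hVdom hwn)
  rw [← hwψ, ← hΦw, ← EReal.coe_add, EReal.coe_le_coe_iff] at hq
  rw [← hwψ, EReal.coe_lt_coe_iff] at hψw
  rw [← hΦw, ← hΦwu, ← EReal.coe_sub, ← EReal.coe_div, EReal.coe_lt_coe_iff,
    div_lt_iff₀ ht0] at hq1
  have hlip := hC.dist_le_mul _ hwn _ hwu
  rw [Real.dist_eq, dist_eq_norm,
    show w + t • (z - w) - (w + t • (z - x)) = t • (x - w) by module, norm_smul,
    Real.norm_of_nonneg ht0.le, norm_sub_rev x w] at hlip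
  replace hlip := (abs_le.1 hlip).2
  have hconv := h.convex w z (1 - t) t (by linarith) ht0 (by ring)
  rw [show (1 - t) • w + t • z = w + t • (z - w) by module, ← hwψ, ← hψz, ← EReal.coe_mul,
    ← EReal.coe_mul, ← EReal.coe_add] at hconv
  rw [← hΦwn]
  refine (add_le_add hconv le_rfl).trans ?_
  rw [← EReal.coe_add, EReal.coe_le_coe_iff]
  have h1 : t * (C * ‖w - x‖) ≤ t * θ := mul_le_mul_of_nonneg_left hCw.le ht0.le
  have h2 : t * (ε * ‖z - w‖) ≤ t * (ε * ‖z - x‖ + θ) := mul_le_mul_of_nonneg_left hnw.le ht0.le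
  have h3 : t * (px - θ) ≤ t * (ψ w).toReal := mul_le_mul_of_nonneg_left hψw.le ht0.le
  have h4 : t * (4 * θ) = t * (-(ε * ‖z - x‖) - (k + pz - px)) := by rw [hθ]; ring
  linarith

theorem IsAdmissible.descendsNear (h : IsAdmissible ψ Φ) {x : X}
    (hx : x ∈ effDomain Φ ∩ effDomain ψ) {ε : ℝ}
    (hnot : ¬ ∀ z, ((-(ε * ‖z - x‖) : ℝ) : EReal) ≤ clarkeDeriv Φ x (z - x) + ψ z - ψ x) :
    DescendsNear (fun x => ψ x + Φ x) ε x := by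
  push Not at hnot
  obtain ⟨z, hz⟩ := hnot
  have hzx : z ≠ x := by
    rintro rfl
    obtain ⟨C, hC⟩ := h.locallyLipschitz.le_clarkeDeriv h.lip_ne_bot hx.1
    have h0 := hC 0
    rw [sub_self, norm_zero, ← coe_toReal_of_mem h.convex_ne_bot hx.2] at hz
    simp only [norm_zero, mul_zero, neg_zero, EReal.coe_zero] at h0 hz
    refine absurd hz (not_lt.2 ?_)
    rwa [EReal.add_sub_cancel_right]
  have hr : 0 < ‖z - x‖ / 2 := half_pos (norm_pos_iff.2 (sub_ne_zero.2 hzx))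
  set r := ‖z - x‖ / 2 with hrdef
  obtain ⟨⟨r₁, t₁⟩, ⟨hr₁, ht₁⟩, hsub⟩ :=
    (Metric.nhds_basis_ball.prod (nhdsGT_basis (0 : ℝ))).mem_iff.1 (h.eventually_descent hx hz)
  simp only at hr₁ ht₁ hsub
  have hmax : ∀ w, 0 < max ‖z - w‖ r := fun w => lt_max_of_lt_right hr
  -- The motion towards `z`, by exactly `s` in time `s` near `x`; the maximum with `r`, irrelevant
  -- there, makes it continuous on the whole space.
  refine ⟨min r₁ r, lt_min hr₁ hr, t₁ * r / 2, by positivity,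
    fun s w => w + (s / max ‖z - w‖ r) • (z - w), ?_, fun w => by simp, ?_, ?_⟩
  · have : Continuous fun p : ℝ × X => p.1 / max ‖z - p.2‖ r :=
      continuous_fst.div (by fun_prop) fun p => (hmax p.2).ne'
    fun_prop
  · intro s hs w
    rw [dist_eq_norm, add_sub_cancel_left, norm_smul, Real.norm_of_nonneg
      (div_nonneg hs (hmax w).le), div_mul_eq_mul_div, div_le_iff₀ (hmax w)]
    exact mul_le_mul_of_nonneg_left (le_max_left _ _) hs
  · intro w hw s hs q hq
    have hwx : ‖w - x‖ < min r₁ r := by rwa [← dist_eq_norm]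
    have hzw : r ≤ ‖z - w‖ := by
      have := norm_sub_le_norm_sub_add_norm_sub z w x
      have := hwx.trans_le (min_le_right _ _)
      linarith
    have hzw0 : 0 < ‖z - w‖ := hr.trans_le hzw
    rcases hs.1.eq_or_lt with rfl | hs0
    · simpa using hq
    · simp only [max_eq_left hzw]
      have h1 := hsub (show (w, s / ‖z - w‖) ∈ Metric.ball x r₁ ×ˢ Ioo 0 t₁ from
        ⟨Metric.ball_subset_ball (min_le_left _ _) hw, div_pos hs0 hzw0, by
          rw [div_lt_iff₀ hzw0]
          have := hs.2
          nlinarith⟩) q hq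
      simpa [div_mul_cancel₀ _ hzw0.ne'] using h1

end Admissible

/-! ### From accuracies to sequences -/

/-- If `P n ε` holds for each `ε > 0` once `n` is large, then it holds for large `n` along a
sequence of accuracies tending to `0`. -/
theorem exists_seq_of_forall_eventually {P : ℕ → ℝ → Prop}
    (hmono : ∀ n ε ε', ε ≤ ε' → P n ε → P n ε') (hP : ∀ ε > 0, ∀ᶠ n in atTop, P n ε) :
    ∃ e : ℕ → ℝ, (∀ n, 0 < e n) ∧ Tendsto e atTop (𝓝 0) ∧ ∀ᶠ n in atTop, P n (e n) := by
  have hbdd : ∀ n, BddBelow {ε | 0 < ε ∧ P n ε} := fun n => ⟨0, fun ε hε => hε.1.le⟩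
  have hnonneg : ∀ n, 0 ≤ sInf {ε | 0 < ε ∧ P n ε} := fun n =>
    Real.sInf_nonneg fun ε hε => hε.1.le
  have hpos : ∀ n : ℕ, (0 : ℝ) < 1 / ((n : ℝ) + 1) := fun n => Nat.one_div_pos_of_nat
  refine ⟨fun n => sInf {ε | 0 < ε ∧ P n ε} + 1 / ((n : ℝ) + 1),
    fun n => add_pos_of_nonneg_of_pos (hnonneg n) (hpos n), ?_, ?_⟩
  · have h1 : Tendsto (fun n => sInf {ε | 0 < ε ∧ P n ε}) atTop (𝓝 0) := by
      refine tendsto_order.2 ⟨fun a ha => .of_forall fun n => ha.trans_le (hnonneg n),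
        fun a ha => ?_⟩
      filter_upwards [hP (a / 2) (half_pos ha)] with n hn
      exact (csInf_le (hbdd n) ⟨half_pos ha, hn⟩).trans_lt (half_lt_self ha)
    simpa using h1.add tendsto_one_div_add_atTop_nhds_zero_nat
  · filter_upwards [hP 1 one_pos] with n hn
    obtain ⟨ε, hε, hlt⟩ := exists_lt_of_csInf_lt (s := {ε | 0 < ε ∧ P n ε}) ⟨1, one_pos, hn⟩
      (lt_add_of_pos_right (sInf {ε | 0 < ε ∧ P n ε}) (hpos n))
    exact hmono n ε _ hlt.le hε.2

end NonsmoothMinMax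

theorem mainTheorem3 {X : Type*} [NormedAddCommGroup X] [NormedSpace ℝ X] [CompleteSpace X]
    (ψ Φ I : X → EReal) (hI : ∀ x, I x = ψ x + Φ x)
    (hadm : NonsmoothMinMax.IsAdmissible ψ Φ)
    (B : Set X) (hB : IsClosed B)
    (ℱ : Set (Set X)) (hcompact : ∀ A ∈ ℱ, IsCompact A)
    (hstable : NonsmoothMinMax.HomotopyStable (NonsmoothMinMax.effDomain Φ) B ℱ)
    (c : ℝ) (hc : (⨅ A ∈ ℱ, ⨆ x ∈ A, I x) = (c : EReal))
    (F : Set X) (hF : IsClosed F)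
    (hmeet : ∀ A ∈ ℱ, ((A ∩ F) \ B).Nonempty)
    (hsep : (⨆ x ∈ B, I x) ≤ ⨅ x ∈ F, I x)
    (A : ℕ → Set X) (hA : ∀ n, A n ∈ ℱ)
    (hAlim : Tendsto (fun n => ⨆ x ∈ A n, I x) atTop (𝓝 (c : EReal))) :
    ∃ x : ℕ → X, NonsmoothMinMax.IsPalaisSmaleSeq ψ Φ c x ∧
      Tendsto (fun n => Metric.infDist (x n) (A n)) atTop (𝓝 0) ∧
      ((⨅ y ∈ F, I y) = (c : EReal) →
        Tendsto (fun n => Metric.infDist (x n) F) atTop (𝓝 0)) := by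
  open NonsmoothMinMax in
  obtain rfl : I = fun x => ψ x + Φ x := funext hI
  let P : ℕ → ℝ → Prop := fun n ε => ∃ x, ψ x + Φ x ≤ (c + ε : ℝ) ∧
    ((c - ε : ℝ) : EReal) ≤ ψ x + Φ x ∧ Metric.infDist x (A n) ≤ ε ∧
    ((⨅ y ∈ F, ψ y + Φ y) = (c : EReal) → Metric.infDist x F ≤ ε) ∧
    ∀ z, ((-(ε * ‖z - x‖) : ℝ) : EReal) ≤ clarkeDeriv Φ x (z - x) + ψ z - ψ x
  have hmono : ∀ n ε ε', ε ≤ ε' → P n ε → P n ε' := by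
    rintro n ε ε' hεε' ⟨x, h1, h2, h3, h4, h5⟩
    refine ⟨x, h1.trans (EReal.coe_le_coe_iff.2 (by linarith)),
      (EReal.coe_le_coe_iff.2 (by linarith)).trans h2, h3.trans hεε', fun h => (h4 h).trans hεε',
      fun z => (EReal.coe_le_coe_iff.2 ?_).trans (h5 z)⟩
    have := mul_le_mul_of_nonneg_right hεε' (norm_nonneg (z - x))
    linarith
  have hP : ∀ ε > 0, ∀ᶠ n in atTop, P n ε := by
    intro ε hε
    obtain ⟨δ, hδ, hcrit⟩ := exists_almostCritical hadm.add_ne_bot hadm.lowerSemicontinuous_add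
      (fun b K hK hKb => hadm.continuousOn_toReal_add hK hKb)
      (fun x hx => (hadm.mem_domain hx).1) hB hcompact hstable hc hmeet hsep hε
    filter_upwards [hAlim.eventually
      (gt_mem_nhds (EReal.coe_lt_coe_iff.2 (lt_add_of_pos_right c hδ)))] with n hn
    obtain ⟨x, h1, h2, h3, h4, h5⟩ := hcrit (A n) (hA n) fun a ha =>
      (le_iSup₂ (f := fun x (_ : x ∈ A n) => ψ x + Φ x) a ha).trans hn.le
    refine ⟨x, h1, h2, h3, h4, ?_⟩
    by_contra hnot
    exact h5 (hadm.descendsNear (hadm.mem_domain (h1.trans_lt (EReal.coe_lt_top _))) hnot)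
  obtain ⟨e, he0, he, heP⟩ := exists_seq_of_forall_eventually hmono hP
  obtain ⟨N, hN⟩ := eventually_atTop.1 heP
  choose! x h1 h2 h3 h4 h5 using hN
  -- the finitely many first terms are irrelevant, and are replaced by the `N`-th one
  have hmax : Tendsto (fun n => max n N) atTop atTop :=
    tendsto_atTop_mono (fun n => le_max_left n N) tendsto_id
  have he' := he.comp hmax
  refine ⟨fun n => x (max n N), ⟨fun n => ?_, ?_, fun n => e (max n N), fun n => he0 _, he',
    fun n => h5 _ (le_max_right n N)⟩, ?_, fun hFc => ?_⟩
  · exact hadm.mem_domain ((h1 _ (le_max_right n N)).trans_lt (EReal.coe_lt_top _))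
  · have hup : Tendsto (fun n => ((c + e (max n N) : ℝ) : EReal)) atTop (𝓝 (c : EReal)) :=
      EReal.tendsto_coe.2 (by simpa using he'.const_add c)
    have hlow : Tendsto (fun n => ((c - e (max n N) : ℝ) : EReal)) atTop (𝓝 (c : EReal)) :=
      EReal.tendsto_coe.2 (by simpa using he'.const_sub c)
    exact tendsto_of_tendsto_of_tendsto_of_le_of_le hlow hup
      (fun n => h2 _ (le_max_right n N)) fun n => h1 _ (le_max_right n N)
  · refine squeeze_zero' (.of_forall fun n => Metric.infDist_nonneg) ?_ he
    filter_upwards [eventually_ge_atTop N] with n hn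
    simpa [max_eq_left hn] using h3 n hn
  · exact squeeze_zero (fun n => Metric.infDist_nonneg)
      (fun n => h4 _ (le_max_right n N) hFc) he'
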